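/- Let $\mathcal H$ be a separable complex Hilbert space (of finite or infinite dimension), and let $\rho_1,\rho_2$ be density operators on $\mathcal H$, i.e. positive bounded operators of trace $1$. For a density operator $\rho$, let $\lambda(\rho)=(\lambda_1(\rho),\lambda_2(\rho),\dots)$ be the sequence of its positive eigenvalues in non-increasing order, repeated according to multiplicity and continued by zeros if there are only finitely many of them, and let $S(\rho)=-\operatorname{tr}(\rho\log_2\rho)\in[0,\infty]$ be its von Neumann entropy (with $0\log_2 0=0$). Write $\rho_1\prec\rho_2$ ($\rho_1$ is majorized by $\rho_2$) if $$\sum_{i=1}^k\lambda_i(\rho_1)\le\sum_{i=1}^k\lambda_i(\rho_2)\quad\text{for } k=1,2,\dots,\qquad\text{and}\qquad \sum_{i=1}^\infty\lambda_i(\rho_1)=\sum_{i=1}^\infty\lambda_i(\rho_2).$$ **Proposition.** If $\rho_1\prec\rho_2$ and $S(\rho_1)=S(\rho_2)<\infty$, then $\rho_1$ and $\rho_2$ are $\mathcal L^1$-equivalent, that is, there is a sequence $(U_n)_{n\ge1}$ of unitary operators on $\mathcal H$ such that $$\lim_{n\to\infty}\|\rho_1-U_n\rho_2U_n^*\|_1=0,$$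 where $\|T\|_1=\operatorname{tr}|T|$ with $|T|=(T^*T)^{1/2}$ is the trace norm. -/

import Mathlib

open scoped ENNReal Topology InnerProductSpace

noncomputable section

namespace QuantumState

variable {H : Type*} [NormedAddCommGroup H] [InnerProductSpace ℂ H]

/-- Parseval's identity in `[0, ∞]`. -/
theorem ofReal_norm_sq_eq_tsum {ι : Type*} (b : HilbertBasis ι ℂ H) (x : H) :
    ENNReal.ofReal (‖x‖ ^ 2) = ∑' i, ENNReal.ofReal (‖⟪b i, x⟫_ℂ‖ ^ 2) := by
  have h3 := Complex.hasSum_re (b.hasSum_inner_mul_inner x x)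
  have e1 : (⟪x, x⟫_ℂ).re = ‖x‖ ^ 2 := by
    rw [inner_self_eq_norm_sq_to_K]; norm_cast
  have e2 : ∀ i, (⟪x, b i⟫_ℂ * ⟪b i, x⟫_ℂ).re = ‖⟪b i, x⟫_ℂ‖ ^ 2 := by
    intro i
    rw [← inner_conj_symm x (b i), ← Complex.normSq_eq_conj_mul_self, Complex.ofReal_re,
      Complex.normSq_eq_norm_sq]
  simp only [e1, e2] at h3
  rw [← h3.tsum_eq, ENNReal.ofReal_tsum_of_nonneg (fun _ => by positivity) h3.summable]

variable [CompleteSpace H]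

/-- Trace of a positive operator as an element of `[0, ∞]`: the sum of the diagonal entries
`⟪e, A e⟫` over a fixed orthonormal (Hilbert) basis of `H`. By `posTrace_eq_tsum` below the value
does not depend on the basis. It is only used for positive operators. -/
def posTrace (A : H →L[ℂ] H) : ℝ≥0∞ :=
  ∑' e : (exists_hilbertBasis ℂ H).choose, ENNReal.ofReal (⟪(e : H), A (e : H)⟫_ℂ).re

theorem tsum_diag_eq_of_nonneg {ι κ : Type*} (b : HilbertBasis ι ℂ H) (c : HilbertBasis κ ℂ H)
    {A : H →L[ℂ] H} (hA : 0 ≤ A) :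
    ∑' i, ENNReal.ofReal (⟪b i, A (b i)⟫_ℂ).re = ∑' j, ENNReal.ofReal (⟪c j, A (c j)⟫_ℂ).re := by
  set R : H →L[ℂ] H := CFC.sqrt A with hR
  have hRR : R * R = A := CFC.sqrt_mul_sqrt_self A hA
  have hRs : ∀ x y : H, ⟪R x, y⟫_ℂ = ⟪x, R y⟫_ℂ := by
    have h : IsSelfAdjoint R := (CFC.sqrt_nonneg A).isSelfAdjoint
    intro x y
    rw [← ContinuousLinearMap.adjoint_inner_right, ← ContinuousLinearMap.star_eq_adjoint, h.star_eq]
  have hdiag : ∀ x : H, (⟪x, A x⟫_ℂ).re = ‖R x‖ ^ 2 := by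
    intro x
    rw [← hRR, mul_apply_eq_comp, ← hRs, inner_self_eq_norm_sq_to_K]
    norm_cast
  simp only [hdiag]
  rw [tsum_congr fun i => ofReal_norm_sq_eq_tsum c (R (b i)), tsum_congr fun j => ofReal_norm_sq_eq_tsum b (R (c j)),
    ENNReal.tsum_comm]
  refine tsum_congr fun j => tsum_congr fun i => ?_
  rw [← hRs, norm_inner_symm]

/-- The trace of a positive operator may be computed in every Hilbert basis. -/
theorem posTrace_eq_tsum {ι : Type*} (b : HilbertBasis ι ℂ H) {A : H →L[ℂ] H} (hA : 0 ≤ A) :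
    posTrace A = ∑' i, ENNReal.ofReal (⟪b i, A (b i)⟫_ℂ).re := by
  obtain ⟨c, hc⟩ := (exists_hilbertBasis ℂ H).choose_spec
  rw [tsum_diag_eq_of_nonneg b c hA, hc]
  rfl

/-- Trace norm `‖T‖₁ = tr |T|` with `|T| = (T* T)^{1/2}`; it is `∞` if `T` is not trace class. -/
def traceNorm (T : H →L[ℂ] H) : ℝ≥0∞ :=
  posTrace (CFC.abs T)

/-- Density operators (quantum states) on `H`: positive bounded operators of trace one. -/
structure IsDensityOperator (ρ : H →L[ℂ] H) : Prop where
  nonneg : 0 ≤ ρ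
  trace_eq_one : posTrace ρ = 1

/-- The von Neumann entropy `S(ρ) = - tr (ρ log₂ ρ) ∈ [0, ∞]` of a density operator. The operator
`- ρ log₂ ρ` is the function `x ↦ - x log₂ x` (with `0 log 0 = 0`), which is continuous, applied
to `ρ`. It is positive, since the spectrum of `ρ` lies in `[0, 1]`. -/
def vonNeumannEntropy (ρ : H →L[ℂ] H) : ℝ≥0∞ :=
  posTrace (cfc (fun x : ℝ => -(x * Real.logb 2 x)) ρ)

/-- The span of all eigenvectors of `ρ` that belong to real eigenvalues `μ ≥ t`. Eigenspaces of
distinct eigenvalues being independent, its dimension is the number of eigenvalues `≥ t`,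
counted with multiplicity. -/
def eigenspacesAbove (ρ : H →L[ℂ] H) (t : ℝ) : Submodule ℂ H :=
  ⨆ μ : Set.Ici t, Module.End.eigenspace (ρ : H →ₗ[ℂ] H) ((μ : ℝ) : ℂ)

/-- The sequence `λ(ρ)` of eigenvalues of a density operator `ρ`, in non-increasing order and
repeated according to multiplicity; if `ρ` has only finitely many positive eigenvalues, then the
sequence continues with zeros. The index starts at `0`: the `n`-th term is the largest `t > 0` such
that at least `n + 1` eigenvalues, counted with multiplicity, are `≥ t`, and it is `0` if there is
no such `t`. -/
def eigenvalueSeq (ρ : H →L[ℂ] H) (n : ℕ) : ℝ :=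
  sSup {t : ℝ | 0 < t ∧ (n : Cardinal) < Module.rank ℂ (eigenspacesAbove ρ t)}

/-- Majorization `r ≺ s` of sequences that decrease to `0` (so that they are their own
non-increasing rearrangements): the partial sums of `r` are at most those of `s`, and the full sums,
taken in `[0, ∞]`, agree. -/
def SeqMajorizedBy (r s : ℕ → ℝ) : Prop :=
  (∀ k : ℕ, ∑ i ∈ Finset.range k, r i ≤ ∑ i ∈ Finset.range k, s i) ∧
    ∑' i, ENNReal.ofReal (r i) = ∑' i, ENNReal.ofReal (s i)

/-- Majorization `ρ ≺ σ` of density operators: `λ(ρ) ≺ λ(σ)`. -/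
def MajorizedBy (ρ σ : H →L[ℂ] H) : Prop :=
  SeqMajorizedBy (eigenvalueSeq ρ) (eigenvalueSeq σ)

/-- `ρ` and `σ` are `L¹`-equivalent: there are unitaries `U n` with `‖ρ - U n σ (U n)*‖₁ → 0`. -/
def L1Equivalent (ρ σ : H →L[ℂ] H) : Prop :=
  ∃ U : ℕ → unitary (H →L[ℂ] H),
    Filter.Tendsto
      (fun n => traceNorm (ρ - (U n : H →L[ℂ] H) * σ * star (U n : H →L[ℂ] H)))
      Filter.atTop (𝓝 0)

end QuantumState

end

/-! Majorization together with equal finite entropy forces the eigenvalue sequences to coincide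
(`eq_of_sum_le_of_entropy_eq`). The termwise gaps between the concave function `Real.negMulLog` and
its tangents at `r n` are non-negative; by summation by parts and finiteness of the entropy their
sum is at most `0`, so each gap vanishes. Equal spectra then give `L1Equivalent`. The kernels may
have different dimensions, so one unitary need not suffice, but matching finitely many eigenvectors
that carry almost all the trace makes the trace norm small (`exists_unitary_traceNorm_sub_conj_le`).
The link is diagonalization: a density operator is compact, hence has an eigenbasis, from which
entropy, trace norm and `eigenvalueSeq` can be read off. -/

namespace QuantumState

universe u

variable {H : Type u} [NormedAddCommGroup H] [InnerProductSpace ℂ H]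

/-! ### Diagonalization of density operators -/

theorem aeval_apply_of_apply_eq_smul {T : H →L[ℂ] H} {x : H} {μ : ℝ} (hx : T x = (μ : ℂ) • x)
    (p : Polynomial ℝ) : Polynomial.aeval T p x = ((p.eval μ : ℝ) : ℂ) • x := by
  induction p using Polynomial.induction_on' with
  | add p q hp hq => simp [hp, hq, add_smul]
  | monomial n a =>
    have hpow : ∀ n : ℕ, (T ^ n) x = ((μ : ℂ) ^ n) • x := by
      intro n
      induction n with
      | zero => simp
      | succ n ih => rw [pow_succ', mul_apply_eq_comp, ih, map_smul, hx, smul_smul, pow_succ]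
    rw [Polynomial.aeval_monomial, mul_apply_eq_comp, hpow, Polynomial.eval_monomial,
      Algebra.algebraMap_eq_smul_one, smul_apply,
      one_apply_eq_self]
    push_cast
    rw [mul_smul]
    rfl

variable [CompleteSpace H]

/-- The continuous functional calculus acts on eigenvectors through the eigenvalue. -/
theorem cfc_apply_of_apply_eq_smul {T : H →L[ℂ] H} (hT : IsSelfAdjoint T) {f : ℝ → ℝ}
    (hf : Continuous f) {x : H} {μ : ℝ} (hx : T x = (μ : ℂ) • x) :
    cfc f T x = ((f μ : ℝ) : ℂ) • x := by
  rcases eq_or_ne x 0 with rfl | hx0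
  · simp
  have hx0' : 0 < ‖x‖ := norm_pos_iff.2 hx0
  -- This interval contains both `μ` and the spectrum, so one Weierstrass polynomial approximates
  -- `f` at the eigenvalue and in operator norm.
  have hmem : μ ∈ Set.Icc (-‖T‖) ‖T‖ := by
    have h := T.le_opNorm x
    rw [hx, norm_smul, Complex.norm_real, Real.norm_eq_abs] at h
    exact abs_le.1 (le_of_mul_le_mul_right h hx0')
  have hspec : ∀ y ∈ spectrum ℝ T, y ∈ Set.Icc (-‖T‖) ‖T‖ := by
    intro y hy
    have hn : Nontrivial H := ⟨x, 0, hx0⟩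
    exact abs_le.1 (spectrum.norm_le_norm_of_mem hy)
  have key : ∀ ε : ℝ, 0 < ε → ‖cfc f T x - ((f μ : ℝ) : ℂ) • x‖ ≤ ε * (2 * ‖x‖) := by
    intro ε hε
    obtain ⟨p, hp⟩ := exists_polynomial_near_of_continuousOn _ _ f hf.continuousOn ε hε
    have h1 : ‖cfc f T - Polynomial.aeval T p‖ ≤ ε := by
      rw [← cfc_polynomial p T hT, ← cfc_sub f (fun x => p.eval x) T hf.continuousOn
        p.continuous.continuousOn]
      refine norm_cfc_le hε.le fun y hy => ?_
      rw [Real.norm_eq_abs, abs_sub_comm]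
      exact (hp y (hspec y hy)).le
    have h2 : cfc f T x - ((f μ : ℝ) : ℂ) • x =
        (cfc f T - Polynomial.aeval T p) x + ((p.eval μ - f μ : ℝ) : ℂ) • x := by
      rw [sub_apply, aeval_apply_of_apply_eq_smul hx]
      push_cast
      rw [sub_smul]
      abel
    rw [h2]
    calc _ ≤ ‖(cfc f T - Polynomial.aeval T p) x‖ + ‖((p.eval μ - f μ : ℝ) : ℂ) • x‖ :=
          norm_add_le _ _
      _ ≤ ε * ‖x‖ + ε * ‖x‖ := by
          refine add_le_add ((ContinuousLinearMap.le_opNorm _ _).trans ?_) ?_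
          · gcongr
          · rw [norm_smul, Complex.norm_real, Real.norm_eq_abs]
            have := (hp μ hmem).le
            gcongr
      _ = _ := by ring
  rw [← sub_eq_zero, ← norm_le_zero_iff]
  refine le_of_forall_pos_le_add fun δ hδ => ?_
  have := key (δ / (2 * ‖x‖)) (by positivity)
  rw [div_mul_cancel₀ _ (by positivity)] at this
  simpa using this

/-- Cauchy–Schwarz on each coefficient `⟪c j, R x⟫ = ⟪R (c j), x⟫`: the Hilbert–Schmidt tail of `R`
controls its distance to finite-rank truncations. -/
theorem norm_sub_sum_sq_le {ι : Type*} (c : HilbertBasis ι ℂ H) {R : H →L[ℂ] H}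
    (hR : IsSelfAdjoint R) (F : Finset ι) (x : H) :
    ENNReal.ofReal (‖R x - ∑ i ∈ F, ⟪c i, R x⟫_ℂ • c i‖ ^ 2) ≤
      (∑' i : {i // i ∉ F}, ENNReal.ofReal (‖R (c i)‖ ^ 2)) * ENNReal.ofReal (‖x‖ ^ 2) := by
  classical
  have hRs : ∀ x y : H, ⟪R x, y⟫_ℂ = ⟪x, R y⟫_ℂ := by
    intro x y
    rw [← ContinuousLinearMap.adjoint_inner_right, ← ContinuousLinearMap.star_eq_adjoint, hR.star_eq]
  rw [ofReal_norm_sq_eq_tsum c, ← ENNReal.tsum_mul_right]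
  have hc : ∀ j, ⟪c j, R x - ∑ i ∈ F, ⟪c i, R x⟫_ℂ • c i⟫_ℂ =
      if j ∈ F then 0 else ⟪c j, R x⟫_ℂ := by
    intro j
    have ho := orthonormal_iff_ite.1 c.orthonormal
    simp only [inner_sub_right, inner_sum, inner_smul_right, ho]
    by_cases hj : j ∈ F <;> simp [hj]
  refine le_of_le_of_eq ?_ (tsum_subtype {i | i ∉ F}
    fun i => ENNReal.ofReal (‖R (c i)‖ ^ 2) * ENNReal.ofReal (‖x‖ ^ 2)).symm
  refine ENNReal.tsum_le_tsum fun j => ?_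
  rw [hc]
  by_cases hj : j ∈ F
  · simp [hj]
  · rw [Set.indicator_of_mem (by exact hj), if_neg hj, ← ENNReal.ofReal_mul (by positivity),
      ← hRs, ← mul_pow]
    exact ENNReal.ofReal_le_ofReal (by gcongr; exact norm_inner_le_norm _ _)

/-- The diagonal entries of `A` are `‖√A (c i)‖²`, so `√A` is Hilbert–Schmidt, hence a norm limit of
finite-rank operators, and `A = √A * √A`. -/
theorem isCompactOperator_of_posTrace_ne_top {A : H →L[ℂ] H} (hA : 0 ≤ A)
    (htr : posTrace A ≠ ∞) : IsCompactOperator A := by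
  obtain ⟨w, c, -⟩ := exists_hilbertBasis ℂ H
  set R : H →L[ℂ] H := CFC.sqrt A
  have hRR : R * R = A := CFC.sqrt_mul_sqrt_self A hA
  have hRsa : IsSelfAdjoint R := (CFC.sqrt_nonneg A).isSelfAdjoint
  have hdiag : ∀ x : H, (⟪x, A x⟫_ℂ).re = ‖R x‖ ^ 2 := by
    intro x
    rw [← hRR, mul_apply_eq_comp, ← ContinuousLinearMap.adjoint_inner_left,
      ← ContinuousLinearMap.star_eq_adjoint, hRsa.star_eq, inner_self_eq_norm_sq_to_K]
    norm_cast
  rw [posTrace_eq_tsum c hA] at htr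
  simp only [hdiag] at htr
  have hlim := ENNReal.tendsto_tsum_compl_atTop_zero htr
  let P : Finset w → H →L[ℂ] H := fun F => ∑ i ∈ F, InnerProductSpace.rankOne ℂ (c i) (c i)
  have hP : ∀ F, IsCompactOperator (P F) := by
    intro F
    refine (compactOperator (RingHom.id ℂ) H H).sum_mem fun i _ => ?_
    change IsCompactOperator (InnerProductSpace.rankOne ℂ (c i) (c i))
    have h1 := (isCompactOperator_of_locallyCompactSpace_rng
      (ContinuousLinearMap.toSpanSingleton ℂ (c i))).comp_clm (innerSL ℂ (c i))
    have h2 : ⇑(InnerProductSpace.rankOne ℂ (c i) (c i)) =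
        ⇑(ContinuousLinearMap.toSpanSingleton ℂ (c i)) ∘ innerSL ℂ (c i) := by
      funext x
      simp
    rwa [h2]
  have hcomp : IsCompactOperator R := by
    refine isCompactOperator_of_tendsto (l := Filter.atTop) (F := fun F => P F ∘L R) (f := R) ?_
      (Filter.Eventually.of_forall fun F => (hP F).comp_clm R)
    rw [tendsto_iff_norm_sub_tendsto_zero, Metric.tendsto_nhds]
    intro ε hε
    have hε2 : 0 < ENNReal.ofReal ((ε / 2) ^ 2) := by simp; positivity
    filter_upwards [hlim.eventually (gt_mem_nhds hε2)] with F hF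
    have hbound : ‖P F ∘L R - R‖ ≤ ε / 2 := by
      refine ContinuousLinearMap.opNorm_le_bound _ (by positivity) fun x => ?_
      have h1 := (norm_sub_sum_sq_le c hRsa F x).trans (mul_le_mul_left hF.le _)
      rw [← ENNReal.ofReal_mul (by positivity), ENNReal.ofReal_le_ofReal_iff (by positivity),
        ← mul_pow] at h1
      have h2 := abs_le_of_sq_le_sq h1 (by positivity)
      rw [abs_norm, norm_sub_rev] at h2
      simpa [P, sum_apply] using h2
    simp only [dist_zero_right, norm_norm]
    linarith
  rw [← hRR]
  exact hcomp.comp_clm R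

/-- A compact self-adjoint operator has a Hilbert basis of eigenvectors. -/
theorem exists_hilbertBasis_apply_eq_smul {T : H →L[ℂ] H} (hT : IsSelfAdjoint T)
    (hc : IsCompactOperator T) :
    ∃ (ι : Type u) (b : HilbertBasis ι ℂ H) (μ : ι → ℝ), ∀ i, T (b i) = (μ i : ℂ) • b i := by
  have hsymm : (T : H →ₗ[ℂ] H).IsSymmetric := hT.isSymmetric
  let E : ℂ → Submodule ℂ H := fun μ => Module.End.eigenspace (T : H →ₗ[ℂ] H) μ
  have hEc : ∀ μ, CompleteSpace (E μ) := by
    intro μ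
    refine IsClosed.completeSpace_coe (hs := ?_)
    have : (E μ : Set H) = {x | T x = μ • x} := by
      ext x
      simp [E]
    rw [this]
    exact isClosed_eq T.continuous (continuous_const_smul μ)
  choose w c _ using fun μ => exists_hilbertBasis ℂ (E μ)
  have hon := hsymm.orthogonalFamily_eigenspaces.orthonormal_sigma_orthonormal
    (v_family := fun μ => (c μ : w μ → E μ)) fun μ => (c μ).orthonormal
  set v : (Σ μ, w μ) → H := fun a => ((c a.1 a.2 : E a.1) : H) with hv
  replace hon : Orthonormal ℂ v := hon
  -- A vector orthogonal to a basis of every eigenspace is orthogonal to all eigenspaces, hence zero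
  -- by the spectral theorem for compact operators.
  have hperp : (Submodule.span ℂ (Set.range v))ᗮ = ⊥ := by
    rw [eq_bot_iff, ← ContinuousLinearMap.orthogonalComplement_iSup_eigenspaces_eq_bot hc hsymm,
      Submodule.iInf_orthogonal _ |>.symm]
    refine fun x hx => Submodule.mem_iInf _ |>.2 fun μ y hy => ?_
    have h1 := ((c μ).hasSum_repr ⟨y, hy⟩).mapL (E μ).subtypeL
    have h2 := h1.mapL (innerSL ℂ x)
    have h3 : ∀ i, ⟪x, (c μ i : H)⟫_ℂ = 0 := fun i =>
      (Submodule.mem_orthogonal' _ _).1 hx _ (Submodule.subset_span ⟨⟨μ, i⟩, rfl⟩)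
    have h4 : ⟪x, y⟫_ℂ = 0 := by
      have h5 := h2.tsum_eq
      simpa [h3] using h5.symm
    rw [← inner_conj_symm, h4, map_zero]
  let b := HilbertBasis.mkOfOrthogonalEqBot hon hperp
  have hb : ⇑b = v := HilbertBasis.coe_mkOfOrthogonalEqBot hon hperp
  refine ⟨_, b, fun a => a.1.re, fun a => ?_⟩
  have hmem : T (v a) = a.1 • v a := Module.End.mem_eigenspace_iff.1 (c a.1 a.2).2
  have hreal : starRingEnd ℂ a.1 = a.1 :=
    hsymm.conj_eigenvalue_eq_self
      (Module.End.hasEigenvalue_of_hasEigenvector ⟨(c a.1 a.2).2, hon.ne_zero a⟩)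
  rw [hb, Complex.conj_eq_iff_re.1 hreal]
  exact hmem

/-- `T` is diagonal in the Hilbert basis `b`, with diagonal entries `μ`. -/
def IsEigenbasis {ι : Type*} (T : H →L[ℂ] H) (b : HilbertBasis ι ℂ H) (μ : ι → ℝ) : Prop :=
  ∀ i, T (b i) = (μ i : ℂ) • b i

theorem IsDensityOperator.exists_isEigenbasis {ρ : H →L[ℂ] H} (hρ : IsDensityOperator ρ) :
    ∃ (ι : Type u) (b : HilbertBasis ι ℂ H) (μ : ι → ℝ), IsEigenbasis ρ b μ :=
  exists_hilbertBasis_apply_eq_smul hρ.nonneg.isSelfAdjoint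
    (isCompactOperator_of_posTrace_ne_top hρ.nonneg (by simp [hρ.trace_eq_one]))

namespace IsEigenbasis

variable {ι : Type*} {T : H →L[ℂ] H} {b : HilbertBasis ι ℂ H} {μ : ι → ℝ}

omit [CompleteSpace H] in
theorem inner_apply_self (h : IsEigenbasis T b μ) (i : ι) : (⟪b i, T (b i)⟫_ℂ).re = μ i := by
  rw [h i, inner_smul_right, inner_self_eq_norm_sq_to_K, b.orthonormal.1 i]
  simp

theorem posTrace_eq (h : IsEigenbasis T b μ) (hT : 0 ≤ T) :
    posTrace T = ∑' i, ENNReal.ofReal (μ i) := by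
  rw [posTrace_eq_tsum b hT]
  simp only [h.inner_apply_self]

omit [CompleteSpace H] in
theorem nonneg (h : IsEigenbasis T b μ) (hT : 0 ≤ T) (i : ι) : 0 ≤ μ i := by
  rw [← h.inner_apply_self i]
  exact ((ContinuousLinearMap.nonneg_iff_isPositive T).1 hT).re_inner_nonneg_right (b i)

theorem cfc (h : IsEigenbasis T b μ) (hT : IsSelfAdjoint T) {f : ℝ → ℝ} (hf : Continuous f) :
    IsEigenbasis (cfc f T) b (fun i => f (μ i)) :=
  fun i => cfc_apply_of_apply_eq_smul hT hf (h i)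

theorem traceNorm_eq (h : IsEigenbasis T b μ) (hT : IsSelfAdjoint T) :
    traceNorm T = ∑' i, ENNReal.ofReal |μ i| := by
  have h1 : IsEigenbasis (CFC.abs T) b fun i => |μ i| := by
    rw [CFC.abs_eq_cfc_norm T hT]
    exact h.cfc hT continuous_norm
  exact h1.posTrace_eq (CFC.abs_nonneg T)

theorem tsum_eq_one (h : IsEigenbasis T b μ) (hT : IsDensityOperator T) :
    ∑' i, ENNReal.ofReal (μ i) = 1 := by
  rw [← h.posTrace_eq hT.nonneg, hT.trace_eq_one]

theorem le_one (h : IsEigenbasis T b μ) (hT : IsDensityOperator T) (i : ι) : μ i ≤ 1 := by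
  rw [← ENNReal.ofReal_le_one, ← h.tsum_eq_one hT]
  exact ENNReal.le_tsum i

theorem nonneg_of_forall (h : IsEigenbasis T b μ) (hT : IsSelfAdjoint T) (hμ : ∀ i, 0 ≤ μ i) :
    0 ≤ T := by
  rw [ContinuousLinearMap.nonneg_iff_isPositive, ContinuousLinearMap.isPositive_def']
  refine ⟨hT, fun x => ?_⟩
  have hs := b.hasSum_inner_mul_inner (T x) x
  have h1 : ∀ i, ⟪T x, b i⟫_ℂ * ⟪b i, x⟫_ℂ = ((μ i * ‖⟪b i, x⟫_ℂ‖ ^ 2 : ℝ) : ℂ) := by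
    intro i
    rw [← ContinuousLinearMap.adjoint_inner_right, ← ContinuousLinearMap.star_eq_adjoint,
      hT.star_eq, h i, inner_smul_right, ← inner_conj_symm x (b i), mul_assoc,
      ← Complex.normSq_eq_conj_mul_self, Complex.normSq_eq_norm_sq]
    push_cast
    rfl
  simp only [h1] at hs
  have h2 := Complex.hasSum_re hs
  exact h2.nonneg fun i => by
    rw [Complex.ofReal_re]
    have := hμ i
    positivity

theorem vonNeumannEntropy_eq (h : IsEigenbasis T b μ) (hT : IsDensityOperator T) :
    vonNeumannEntropy T = ∑' i, ENNReal.ofReal (-(μ i * Real.logb 2 (μ i))) := by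
  have hcont : Continuous fun x : ℝ => -(x * Real.logb 2 x) := by
    have : (fun x : ℝ => -(x * Real.logb 2 x)) = fun x => -(x * Real.log x / Real.log 2) := by
      ext x
      rw [Real.logb, mul_div_assoc]
    rw [this]
    exact (Real.continuous_mul_log.div_const _).neg
  have h1 := h.cfc hT.nonneg.isSelfAdjoint hcont
  refine h1.posTrace_eq (h1.nonneg_of_forall (cfc_predicate _ _) fun i => ?_)
  rw [Left.nonneg_neg_iff]
  exact mul_nonpos_of_nonneg_of_nonpos (h.nonneg hT.nonneg i)
    (Real.logb_nonpos one_lt_two (h.nonneg hT.nonneg i) (h.le_one hT i))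

end IsEigenbasis

end QuantumState

/-! ### The eigenvalue sequence in terms of an eigenbasis -/

namespace QuantumState

/-- Two families of reals with the same finite counting functions `t ↦ #{i | t ≤ μ i}` on
`(0, ∞)` have the same positive values with the same multiplicities. -/
theorem exists_equiv_of_ncard_eq {ι κ : Type*} {μ : ι → ℝ} {ν : κ → ℝ}
    (hμ : ∀ t, 0 < t → {i | t ≤ μ i}.Finite) (hν : ∀ t, 0 < t → {j | t ≤ ν j}.Finite)
    (h : ∀ t, 0 < t → {i | t ≤ μ i}.ncard = {j | t ≤ ν j}.ncard) :
    ∃ e : {i // 0 < μ i} ≃ {j // 0 < ν j}, ∀ i, ν (e i) = μ i := by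
  have s1 : ∀ v, {i | v < μ i} ⊆ {i | v ≤ μ i} := fun v i (hi : v < μ i) => hi.le
  have s2 : ∀ v, {j | v < ν j} ⊆ {j | v ≤ ν j} := fun v j (hj : v < ν j) => hj.le
  have hlt : ∀ v, 0 < v → {i | v < μ i}.ncard = {j | v < ν j}.ncard := by
    intro v hv
    have hf1 : {i | v < μ i}.Finite := (hμ v hv).subset (s1 v)
    have hf2 : {j | v < ν j}.Finite := (hν v hv).subset (s2 v)
    -- Only finitely many values exceed `v`, so some `w > v` lies below them all and strict counts
    -- at `v` become non-strict counts at `w`.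
    have e1 : ∀ᶠ w in 𝓝[>] v, ∀ i ∈ {i | v < μ i}, w ≤ μ i := hf1.eventually_all.2
      fun i hi => Filter.Eventually.filter_mono nhdsWithin_le_nhds (eventually_le_nhds hi)
    have e2 : ∀ᶠ w in 𝓝[>] v, ∀ j ∈ {j | v < ν j}, w ≤ ν j := hf2.eventually_all.2
      fun i hi => Filter.Eventually.filter_mono nhdsWithin_le_nhds (eventually_le_nhds hi)
    obtain ⟨w, ⟨h1, h2⟩, hw⟩ := ((e1.and e2).and self_mem_nhdsWithin).exists
    have hw : v < w := hw
    have g1 : {i | v < μ i} = {i | w ≤ μ i} :=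
      Set.Subset.antisymm h1 fun i hi => hw.trans_le hi
    have g2 : {j | v < ν j} = {j | w ≤ ν j} :=
      Set.Subset.antisymm h2 fun i hi => hw.trans_le hi
    rw [g1, g2, h w (hv.trans hw)]
  have hfib : ∀ v : Set.Ioi (0 : ℝ), Nonempty
      ({i : {i // 0 < μ i} // (⟨μ i, i.2⟩ : Set.Ioi (0 : ℝ)) = v} ≃
        {j : {j // 0 < ν j} // (⟨ν j, j.2⟩ : Set.Ioi (0 : ℝ)) = v}) := by
    rintro ⟨v, hv : 0 < v⟩
    have key : {i | μ i = v}.ncard = {j | ν j = v}.ncard := by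
      have d1 : {i | μ i = v} = {i | v ≤ μ i} \ {i | v < μ i} := by
        ext i
        simp [le_antisymm_iff, and_comm]
      have d2 : {j | ν j = v} = {j | v ≤ ν j} \ {j | v < ν j} := by
        ext i
        simp [le_antisymm_iff, and_comm]
      rw [d1, d2, Set.ncard_sdiff (s1 v) ((hμ v hv).subset (s1 v)),
        Set.ncard_sdiff (s2 v) ((hν v hv).subset (s2 v)), h v hv, hlt v hv]
    have f1 : Finite {i | μ i = v} := (hμ v hv).subset fun i (hi : _ = v) => hi.ge
    have f2 : Finite {j | ν j = v} := (hν v hv).subset fun i (hi : _ = v) => hi.ge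
    let a : {i : {i // 0 < μ i} // (⟨μ i, i.2⟩ : Set.Ioi (0 : ℝ)) = ⟨v, hv⟩} ≃ {i | μ i = v} :=
      { toFun := fun i => ⟨i.1.1, congrArg Subtype.val i.2⟩
        invFun := fun i => ⟨⟨i.1, hv.trans_eq i.2.symm⟩, Subtype.ext i.2⟩
        left_inv := fun _ => rfl
        right_inv := fun _ => rfl }
    let b : {j : {j // 0 < ν j} // (⟨ν j, j.2⟩ : Set.Ioi (0 : ℝ)) = ⟨v, hv⟩} ≃ {j | ν j = v} :=
      { toFun := fun i => ⟨i.1.1, congrArg Subtype.val i.2⟩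
        invFun := fun i => ⟨⟨i.1, hv.trans_eq i.2.symm⟩, Subtype.ext i.2⟩
        left_inv := fun _ => rfl
        right_inv := fun _ => rfl }
    have hc : Nat.card {i | μ i = v} = Nat.card {j | ν j = v} := by
      rwa [Nat.card_coe_set_eq, Nat.card_coe_set_eq]
    exact ⟨a.trans ((Finite.card_eq.1 hc).some.trans b.symm)⟩
  refine ⟨(Equiv.sigmaFiberEquiv _).symm.trans ((Equiv.sigmaCongrRight fun v => (hfib v).some).trans
    (Equiv.sigmaFiberEquiv _)), fun i => ?_⟩
  exact congrArg Subtype.val ((hfib ⟨μ i, i.2⟩).some ⟨i, rfl⟩).2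

/-- Zero values contribute nothing since `f 0 = 0`; hence their multiplicities need not agree. -/
theorem tsum_comp_eq_of_equiv {ι κ : Type*} {μ : ι → ℝ} {ν : κ → ℝ} (hμ : ∀ i, 0 ≤ μ i)
    (hν : ∀ j, 0 ≤ ν j) (e : {i // 0 < μ i} ≃ {j // 0 < ν j}) (he : ∀ i, ν (e i) = μ i)
    {f : ℝ → ℝ≥0∞} (hf : f 0 = 0) : ∑' i, f (μ i) = ∑' j, f (ν j) := by
  have h1 : ∑' i : {i // 0 < μ i}, f (μ i) = ∑' i, f (μ i) :=
    tsum_subtype_eq_of_support_subset (s := {i | 0 < μ i}) (f := fun i => f (μ i)) fun i hi =>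
      (hμ i).lt_of_ne fun h0 => hi (by simp [← h0, hf])
  have h2 : ∑' j : {j // 0 < ν j}, f (ν j) = ∑' j, f (ν j) :=
    tsum_subtype_eq_of_support_subset (s := {j | 0 < ν j}) (f := fun i => f (ν i)) fun i hi =>
      (hν i).lt_of_ne fun h0 => hi (by simp [← h0, hf])
  rw [← h1, ← h2, ← e.tsum_eq]
  simp only [he]

universe u
variable {H : Type u} [NormedAddCommGroup H] [InnerProductSpace ℂ H]

theorem eigenvalueSeq_nonneg (T : H →L[ℂ] H) (n : ℕ) : 0 ≤ eigenvalueSeq T n :=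
  Real.sSup_nonneg fun _ ht => ht.1.le

namespace IsEigenbasis

variable [CompleteSpace H] {ι : Type*} {T : H →L[ℂ] H} {b : HilbertBasis ι ℂ H} {μ : ι → ℝ}

/-- An eigenvector is orthogonal to every `b i` with a different eigenvalue. By `hfin` its expansion
is finite, so no closure of the span is needed. -/
theorem eigenspacesAbove_eq_span (h : IsEigenbasis T b μ) (hT : IsSelfAdjoint T) {t : ℝ}
    (hfin : {i | t ≤ μ i}.Finite) :
    eigenspacesAbove T t = Submodule.span ℂ (b '' {i | t ≤ μ i}) := by
  refine le_antisymm (iSup_le ?_) (Submodule.span_le.2 ?_)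
  · rintro ⟨m, hm : t ≤ m⟩ x hx
    have hx : T x = (m : ℂ) • x := Module.End.mem_eigenspace_iff.1 hx
    have hcoef : ∀ i, i ∉ hfin.toFinset → b.repr x i • b i = 0 := by
      intro i hi
      have h1 : ⟪b i, T x⟫_ℂ = ⟪T (b i), x⟫_ℂ := (hT.isSymmetric (b i) x).symm
      rw [hx, h i, inner_smul_right, inner_smul_left, Complex.conj_ofReal] at h1
      have h2 : m ≠ μ i := fun h0 => hi (by simp [← h0, hm])
      have h3 : ⟪b i, x⟫_ℂ = 0 := by
        by_contra h0
        exact h2 (by exact_mod_cast mul_right_cancel₀ h0 h1)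
      rw [b.repr_apply_apply, h3, zero_smul]
    rw [← (b.hasSum_repr x).tsum_eq, tsum_eq_sum hcoef]
    refine Submodule.sum_mem _ fun i hi => Submodule.smul_mem _ _ (Submodule.subset_span ?_)
    exact ⟨i, by simpa using hi, rfl⟩
  · rintro _ ⟨i, hi, rfl⟩
    exact Submodule.mem_iSup_of_mem (⟨μ i, hi⟩ : Set.Ici t) (Module.End.mem_eigenspace_iff.2 (h i))

theorem rank_eigenspacesAbove (h : IsEigenbasis T b μ) (hT : IsSelfAdjoint T) {t : ℝ}
    (hfin : {i | t ≤ μ i}.Finite) :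
    Module.rank ℂ (eigenspacesAbove T t) = ({i | t ≤ μ i}.ncard : Cardinal) := by
  have hli := b.orthonormal.linearIndependent
  rw [h.eigenspacesAbove_eq_span hT hfin, rank_span_set (hli.linearIndepOn_id.mono
    (Set.image_subset_range _ _)), ← Set.ncard_image_of_injective _ hli.injective,
    Set.cast_ncard (hfin.image _)]

theorem finite_le (h : IsEigenbasis T b μ) (hT : IsDensityOperator T) {t : ℝ} (ht : 0 < t) :
    {i | t ≤ μ i}.Finite := by
  have h1 := ENNReal.finite_const_le_of_tsum_ne_top (a := fun i => ENNReal.ofReal (μ i))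
    (by simp [h.tsum_eq_one hT]) (ENNReal.ofReal_pos.2 ht).ne'
  exact h1.subset fun i hi => ENNReal.ofReal_le_ofReal hi

/-- The supremum in `eigenvalueSeq` is attained when positive: the counting function is constant
just below `t`, because only finitely many `μ i` are at least `t / 2`. -/
theorem le_eigenvalueSeq_iff (h : IsEigenbasis T b μ) (hT : IsDensityOperator T) {t : ℝ}
    (ht : 0 < t) (n : ℕ) : t ≤ eigenvalueSeq T n ↔ n < {i | t ≤ μ i}.ncard := by
  have hset : {t : ℝ | 0 < t ∧ (n : Cardinal) < Module.rank ℂ (eigenspacesAbove T t)} =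
      {t | 0 < t ∧ n < {i | t ≤ μ i}.ncard} := by
    ext s
    refine and_congr_right fun hs => ?_
    rw [h.rank_eigenspacesAbove hT.nonneg.isSelfAdjoint (h.finite_le hT hs), Nat.cast_lt]
  rw [eigenvalueSeq, hset]
  constructor
  · intro hle
    have hf := h.finite_le hT (half_pos ht)
    have e1 : ∀ᶠ s in 𝓝[<] t, ∀ i ∈ {i | t / 2 ≤ μ i} \ {i | t ≤ μ i}, μ i < s :=
      hf.sdiff.eventually_all.2 fun i hi =>
        Filter.Eventually.filter_mono nhdsWithin_le_nhds (lt_mem_nhds (not_le.1 hi.2))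
    have e2 : ∀ᶠ s in 𝓝[<] t, t / 2 < s :=
      Filter.Eventually.filter_mono nhdsWithin_le_nhds (lt_mem_nhds (half_lt_self ht))
    obtain ⟨s, ⟨h1, h2⟩, hs⟩ := ((e1.and e2).and self_mem_nhdsWithin).exists
    have hs : s < t := hs
    -- Otherwise `sSup ∅ = 0` would contradict `0 < t`.
    have hne : {t | 0 < t ∧ n < {i | t ≤ μ i}.ncard}.Nonempty := by
      by_contra hemp
      rw [Set.not_nonempty_iff_eq_empty.1 hemp, Real.sSup_empty] at hle
      exact absurd hle (not_le.2 ht)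
    obtain ⟨r, ⟨hr0, hr⟩, hsr⟩ := exists_lt_of_lt_csSup hne (hs.trans_le hle)
    refine hr.trans_le (Set.ncard_le_ncard (fun i hi => ?_) (h.finite_le hT ht))
    by_contra hti
    have hi' : s < μ i := hsr.trans_le hi
    exact absurd (h1 i ⟨(h2.trans hi').le, hti⟩) (not_lt.2 hi'.le)
  · intro hlt
    refine le_csSup ⟨1, ?_⟩ ⟨ht, hlt⟩
    rintro s ⟨hs, hn⟩
    obtain ⟨i, hi⟩ := Set.nonempty_of_ncard_ne_zero (Nat.ne_zero_of_lt hn)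
    exact le_trans hi (h.le_one hT i)

theorem setOf_le_eigenvalueSeq (h : IsEigenbasis T b μ) (hT : IsDensityOperator T) {t : ℝ}
    (ht : 0 < t) : {n | t ≤ eigenvalueSeq T n} = Set.Iio {i | t ≤ μ i}.ncard :=
  Set.ext fun n => h.le_eigenvalueSeq_iff hT ht n

theorem exists_equiv_eigenvalueSeq (h : IsEigenbasis T b μ) (hT : IsDensityOperator T) :
    ∃ e : {i // 0 < μ i} ≃ {n // 0 < eigenvalueSeq T n}, ∀ i, eigenvalueSeq T (e i) = μ i := by
  refine exists_equiv_of_ncard_eq (fun t ht => h.finite_le hT ht) (fun t ht => ?_) fun t ht => ?_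
  · rw [h.setOf_le_eigenvalueSeq hT ht]
    exact Set.finite_Iio _
  · rw [h.setOf_le_eigenvalueSeq hT ht, ← Nat.card_coe_set_eq (Set.Iio _)]
    simp

theorem antitone_eigenvalueSeq (h : IsEigenbasis T b μ) (hT : IsDensityOperator T) :
    Antitone (eigenvalueSeq T) := by
  intro m n hmn
  rcases (eigenvalueSeq_nonneg T n).eq_or_lt with h0 | h0
  · rw [← h0]
    exact eigenvalueSeq_nonneg T m
  · rw [h.le_eigenvalueSeq_iff hT h0]
    exact hmn.trans_lt ((h.le_eigenvalueSeq_iff hT h0 n).1 le_rfl)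

theorem tsum_comp_eigenvalueSeq (h : IsEigenbasis T b μ) (hT : IsDensityOperator T)
    {f : ℝ → ℝ≥0∞} (hf : f 0 = 0) : ∑' n, f (eigenvalueSeq T n) = ∑' i, f (μ i) := by
  obtain ⟨e, he⟩ := h.exists_equiv_eigenvalueSeq hT
  exact (tsum_comp_eq_of_equiv (h.nonneg hT.nonneg) (eigenvalueSeq_nonneg T) e he hf).symm

end IsEigenbasis

end QuantumState

/-! ### Strict Schur concavity of the entropy -/

namespace QuantumState

/-- Summation by parts for a non-decreasing weight and non-positive partial sums. -/
theorem mul_sum_le_sum_mul_of_monotone {c d : ℕ → ℝ} (hc : Monotone c)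
    (hd : ∀ k, ∑ i ∈ Finset.range k, d i ≤ 0) (n : ℕ) :
    c n * ∑ i ∈ Finset.range n, d i ≤ ∑ i ∈ Finset.range n, c i * d i := by
  induction n with
  | zero => simp
  | succ n ih =>
    have h1 := mul_le_mul_of_nonpos_right (hc n.le_succ) (hd (n + 1))
    rw [Finset.sum_range_succ (fun i => c i * d i)]
    rw [Finset.sum_range_succ, mul_add] at h1 ⊢
    rw [mul_add] at h1
    linarith

/-- This is `log z ≤ z - 1` at `z = x / y`, with equality only at `z = 1`. -/
theorem le_relative_entropy {x y : ℝ} (hx : 0 < x) (hy : 0 ≤ y) :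
    0 ≤ x - y + y * Real.log y - y * Real.log x ∧
      (x - y + y * Real.log y - y * Real.log x = 0 → x = y) := by
  rcases hy.eq_or_lt with rfl | hy
  · simpa using hx.le
  have hlog : Real.log (x / y) = Real.log x - Real.log y := Real.log_div hx.ne' hy.ne'
  have hmul : y * (x / y - 1) = x - y := by field_simp
  have hxy : 0 < x / y := div_pos hx hy
  refine ⟨?_, fun h0 => ?_⟩
  · have := mul_le_mul_of_nonneg_left (Real.log_le_sub_one_of_pos hxy) hy.le
    rw [hmul, hlog] at this
    linarith
  · by_contra hne
    have := mul_lt_mul_of_pos_left (Real.log_lt_sub_one_of_pos hxy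
      (fun h1 => hne ((div_eq_one_iff_eq hy.ne').1 h1))) hy
    rw [hmul, hlog] at this
    linarith

/-- Strict Schur concavity of the entropy: majorized probability sequences of the same finite
entropy coincide. -/
theorem eq_of_sum_le_of_entropy_eq {r s : ℕ → ℝ} (hr : Antitone r) (hr0 : ∀ n, 0 ≤ r n)
    (hs0 : ∀ n, 0 ≤ s n)
    (hle : ∀ k, ∑ i ∈ Finset.range k, r i ≤ ∑ i ∈ Finset.range k, s i)
    (hr1 : HasSum r 1) (hs1 : HasSum s 1) {E : ℝ} (hrE : HasSum (fun n => Real.negMulLog (r n)) E)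
    (hsE : HasSum (fun n => Real.negMulLog (s n)) E) : r = s := by
  have hrle : ∀ n, r n ≤ 1 := fun n => le_hasSum hr1 n fun j _ => hr0 j
  -- If `r k = 0`, the first `k` terms of `r`, hence also of `s`, exhaust the mass `1`.
  have hzero : ∀ k, r k = 0 → s k = 0 := by
    intro k hk
    have h1 : ∑ i ∈ Finset.range k, r i = 1 := (hasSum_sum_of_ne_finset_zero (fun j hj =>
      le_antisymm (hk ▸ hr (by simpa using hj)) (hr0 j))).unique hr1
    have h2 : ∑ i ∈ Finset.range (k + 1), s i ≤ 1 := sum_le_hasSum _ (fun j _ => hs0 j) hs1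
    rw [Finset.sum_range_succ] at h2
    linarith [hle k, hs0 k]
  -- The running maximum equals `-log (r k)` while `r k > 0` and stays monotone past the zeros of
  -- `r`, where `Real.log 0 = 0` would spoil monotonicity.
  set c : ℕ → ℝ := ⇑(partialSups fun n => -Real.log (r n))
  have hcmono : Monotone c := (partialSups _).monotone
  have hc : ∀ k, 0 < r k → c k = -Real.log (r k) := by
    intro k hk
    refine le_antisymm (partialSups_le _ _ _ fun j hj => ?_)
      (le_partialSups (fun n => -Real.log (r n)) k)
    exact neg_le_neg (Real.log_le_log hk (hr hj))
  -- For `r k > 0` this is the gap at `s k` between `Real.negMulLog` and its tangent at `r k`, whose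
  -- slope is `c k - 1`.
  set g : ℕ → ℝ := fun k => r k - s k + (Real.negMulLog (r k) - Real.negMulLog (s k)) -
    c k * (r k - s k) with hg
  have hgap : ∀ k, 0 ≤ g k ∧ (g k = 0 → r k = s k) := by
    intro k
    rcases (hr0 k).eq_or_lt with hk | hk
    · simp [hg, hzero k hk.symm, ← hk]
    · have := le_relative_entropy hk (hs0 k)
      have he : g k = r k - s k + s k * Real.log (s k) - s k * Real.log (r k) := by
        simp only [hg, hc k hk, Real.negMulLog]
        ring
      rwa [he]
  have hbound : ∀ n, ∑ k ∈ Finset.range n, g k ≤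
      E - ∑ k ∈ Finset.range n, Real.negMulLog (s k) := by
    intro n
    have hD : ∀ k, ∑ i ∈ Finset.range k, (r i - s i) ≤ 0 := fun k => by
      rw [Finset.sum_sub_distrib]
      linarith [hle k]
    have habel := mul_sum_le_sum_mul_of_monotone hcmono hD n
    have hR := hr1.summable.sum_add_tsum_nat_add n
    have hE := hrE.summable.sum_add_tsum_nat_add n
    rw [hr1.tsum_eq] at hR
    rw [hrE.tsum_eq] at hE
    have hS : ∑ i ∈ Finset.range n, s i ≤ 1 := sum_le_hasSum _ (fun j _ => hs0 j) hs1
    -- This absorbs the boundary term of the summation by parts into the entropy tail, since `c n ≤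
    -- -log (r (k + n))` wherever `r (k + n) > 0`.
    have htail : c n * ∑' k, r (k + n) ≤ ∑' k, Real.negMulLog (r (k + n)) := by
      rw [← tsum_mul_left]
      refine Summable.tsum_le_tsum (fun k => ?_)
        (((summable_nat_add_iff n).2 hr1.summable).mul_left _)
        ((summable_nat_add_iff n).2 hrE.summable)
      rcases (hr0 (k + n)).eq_or_lt with hk | hk
      · simp [← hk]
      · have h1 := hcmono (Nat.le_add_left n k)
        rw [hc _ hk] at h1
        have := mul_le_mul_of_nonneg_right h1 hk.le
        rw [Real.negMulLog]
        linarith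
    have hcn : 0 ≤ c n := by
      refine le_trans ?_ (le_partialSups (fun n => -Real.log (r n)) n)
      exact neg_nonneg.2 (Real.log_nonpos (hr0 n) (hrle n))
    have hDn : -∑ i ∈ Finset.range n, (r i - s i) ≤ ∑' k, r (k + n) := by
      rw [Finset.sum_sub_distrib]
      linarith
    have hcD := mul_le_mul_of_nonneg_left hDn hcn
    have hDn0 := hD n
    simp only [hg, Finset.sum_sub_distrib, Finset.sum_add_distrib] at habel hDn0 hcD ⊢
    linarith
  have hlim : Filter.Tendsto (fun n => E - ∑ k ∈ Finset.range n, Real.negMulLog (s k))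
      Filter.atTop (𝓝 0) := by
    simpa using hsE.tendsto_sum_nat.const_sub E
  funext k
  refine (hgap k).2 (le_antisymm ?_ (hgap k).1)
  refine ge_of_tendsto hlim (Filter.eventually_atTop.2 ⟨k + 1, fun n hn => ?_⟩)
  exact (Finset.single_le_sum (f := g) (fun i _ => (hgap i).1)
    (Finset.mem_range.2 hn)).trans (hbound n)

theorem hasSum_of_tsum_ofReal {ι : Type*} {f : ι → ℝ} (hf : ∀ n, 0 ≤ f n) {a : ℝ≥0∞} (ha : a ≠ ∞)
    (h : ∑' n, ENNReal.ofReal (f n) = a) : HasSum f a.toReal := by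
  have h1 := ENNReal.hasSum_toReal (f := fun n => ENNReal.ofReal (f n)) (by rwa [h])
  simp only [ENNReal.toReal_ofReal (hf _)] at h1
  rw [← h, ENNReal.tsum_toReal_eq fun _ => ENNReal.ofReal_ne_top]
  simpa only [ENNReal.toReal_ofReal (hf _)] using h1

universe u
variable {H : Type u} [NormedAddCommGroup H] [InnerProductSpace ℂ H] [CompleteSpace H]

theorem IsDensityOperator.hasSum_eigenvalueSeq {ρ : H →L[ℂ] H} (hρ : IsDensityOperator ρ) :
    HasSum (eigenvalueSeq ρ) 1 := by
  obtain ⟨ι, b, μ, h⟩ := hρ.exists_isEigenbasis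
  have h1 := h.tsum_comp_eigenvalueSeq hρ (f := ENNReal.ofReal) ENNReal.ofReal_zero
  rw [h.tsum_eq_one hρ] at h1
  simpa using hasSum_of_tsum_ofReal (eigenvalueSeq_nonneg ρ) ENNReal.one_ne_top h1

theorem IsDensityOperator.antitone_eigenvalueSeq {ρ : H →L[ℂ] H} (hρ : IsDensityOperator ρ) :
    Antitone (eigenvalueSeq ρ) := by
  obtain ⟨ι, b, μ, h⟩ := hρ.exists_isEigenbasis
  exact h.antitone_eigenvalueSeq hρ

theorem IsDensityOperator.hasSum_negMulLog_eigenvalueSeq {ρ : H →L[ℂ] H}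
    (hρ : IsDensityOperator ρ) (hS : vonNeumannEntropy ρ ≠ ∞) :
    HasSum (fun n => Real.negMulLog (eigenvalueSeq ρ n))
      ((vonNeumannEntropy ρ).toReal * Real.log 2) := by
  obtain ⟨ι, b, μ, h⟩ := hρ.exists_isEigenbasis
  have h1 := h.tsum_comp_eigenvalueSeq hρ
    (f := fun x => ENNReal.ofReal (-(x * Real.logb 2 x))) (by simp)
  rw [← h.vonNeumannEntropy_eq hρ] at h1
  have h2 := hasSum_of_tsum_ofReal (fun n => neg_nonneg.2 (mul_nonpos_of_nonneg_of_nonpos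
    (eigenvalueSeq_nonneg ρ n) (Real.logb_nonpos one_lt_two (eigenvalueSeq_nonneg ρ n)
      (le_hasSum hρ.hasSum_eigenvalueSeq n fun j _ => eigenvalueSeq_nonneg ρ j)))) hS h1
  have h3 : ∀ x, Real.negMulLog x = -(x * Real.logb 2 x) * Real.log 2 := fun x => by
    have : Real.log 2 ≠ 0 := (Real.log_pos one_lt_two).ne'
    rw [Real.negMulLog, Real.logb]
    field_simp
  simp only [h3]
  exact h2.mul_right (Real.log 2)

theorem eigenvalueSeq_eq_of_majorizedBy {ρ σ : H →L[ℂ] H} (hρ : IsDensityOperator ρ)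
    (hσ : IsDensityOperator σ) (h : MajorizedBy ρ σ)
    (hS : vonNeumannEntropy ρ = vonNeumannEntropy σ) (hfin : vonNeumannEntropy σ ≠ ∞) :
    eigenvalueSeq ρ = eigenvalueSeq σ :=
  eq_of_sum_le_of_entropy_eq hρ.antitone_eigenvalueSeq (eigenvalueSeq_nonneg ρ)
    (eigenvalueSeq_nonneg σ) h.1 hρ.hasSum_eigenvalueSeq hσ.hasSum_eigenvalueSeq
    (hS ▸ hρ.hasSum_negMulLog_eigenvalueSeq (hS ▸ hfin))
    (hσ.hasSum_negMulLog_eigenvalueSeq hfin)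

end QuantumState

/-! ### Approximate unitary equivalence from equal spectra -/

namespace QuantumState

universe u
variable {H : Type u} [NormedAddCommGroup H] [InnerProductSpace ℂ H]

theorem countable_of_orthonormal [TopologicalSpace.SeparableSpace H] {ι : Type*} {v : ι → H}
    (hv : Orthonormal ℂ v) : Countable ι := by
  have hdist : ∀ i j, i ≠ j → 1 ≤ dist (v i) (v j) := by
    intro i j hij
    have h := norm_sub_sq (𝕜 := ℂ) (v i) (v j)
    rw [hv.1 i, hv.1 j, hv.2 hij] at h
    rw [dist_eq_norm]
    norm_num at h
    nlinarith [norm_nonneg (v i - v j)]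
  refine Pairwise.countable_of_isOpen_disjoint (s := fun i => Metric.ball (v i) (1 / 2))
    (fun i j hij => Metric.ball_disjoint_ball ?_) (fun i => Metric.isOpen_ball)
    fun i => ⟨v i, Metric.mem_ball_self one_half_pos⟩
  linarith [hdist i j hij]

theorem finite_of_hilbertBasis {ι κ : Type*} [Finite ι] (b : HilbertBasis ι ℂ H) {v : κ → H}
    (hv : Orthonormal ℂ v) : Finite κ := by
  have := Fintype.ofFinite ι
  have : FiniteDimensional ℂ H := b.toOrthonormalBasis.toBasis.finiteDimensional_of_finite
  exact hv.linearIndependent.finite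

/-- Both index sets are finite of size `dim H`, or both are countably infinite by separability. -/
theorem nonempty_equiv_of_hilbertBasis [TopologicalSpace.SeparableSpace H] {ι κ : Type*}
    (b : HilbertBasis ι ℂ H) (c : HilbertBasis κ ℂ H) : Nonempty (ι ≃ κ) := by
  rcases finite_or_infinite ι with hι | hι
  · have := finite_of_hilbertBasis b c.orthonormal
    have := Fintype.ofFinite ι
    have := Fintype.ofFinite κ
    exact ⟨b.toOrthonormalBasis.toBasis.indexEquiv c.toOrthonormalBasis.toBasis⟩
  · have : Infinite κ := by
      by_contra hκ
      have := not_infinite_iff_finite.1 hκ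
      exact not_finite_iff_infinite.2 hι (finite_of_hilbertBasis c b.orthonormal)
    have := countable_of_orthonormal b.orthonormal
    have := countable_of_orthonormal c.orthonormal
    exact nonempty_equiv_of_countable

/-- Finiteness of `s` is essential: an injection on an infinite subset can leave complements of
different sizes. -/
theorem exists_equiv_extending {ι κ : Type*} (h : Nonempty (ι ≃ κ)) (s : Finset ι)
    (f : (s : Set ι) ↪ κ) : ∃ σ : ι ≃ κ, ∀ i : (s : Set ι), σ i = f i := by
  rcases finite_or_infinite ι with hι | hι
  · exact Cardinal.extend_function_finite f h
  · refine Cardinal.extend_function_of_lt f (lt_of_lt_of_le ?_ (Cardinal.aleph0_le_mk ι)) h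
    exact Cardinal.lt_aleph0_of_finite _

variable [CompleteSpace H]

theorem exists_unitary_apply_eq {ι κ : Type*} (b : HilbertBasis ι ℂ H) (c : HilbertBasis κ ℂ H)
    (σ : ι ≃ κ) : ∃ U : unitary (H →L[ℂ] H), ∀ i, (U : H →L[ℂ] H) (c (σ i)) = b i := by
  classical
  have hon : Orthonormal ℂ (fun i => c (σ i)) := c.orthonormal.comp σ σ.injective
  have hsp : ⊤ ≤ (Submodule.span ℂ (Set.range fun i => c (σ i))).topologicalClosure := by
    have : (Set.range fun i => c (σ i)) = Set.range c := σ.surjective.range_comp c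
    rw [this, c.dense_span]
  let c' := HilbertBasis.mk hon hsp
  have hc' : ∀ i, c' i = c (σ i) := fun i => congrFun (HilbertBasis.coe_mk hon hsp) i
  refine ⟨Unitary.linearIsometryEquiv.symm (c'.repr.trans b.repr.symm), fun i => ?_⟩
  rw [Unitary.coe_symm_linearIsometryEquiv_apply, ← hc']
  change b.repr.symm (c'.repr (c' i)) = b i
  rw [c'.repr_self, b.repr_symm_single]

namespace IsEigenbasis

variable {ι κ : Type*} {S T : H →L[ℂ] H} {b : HilbertBasis ι ℂ H} {c : HilbertBasis κ ℂ H}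
  {μ : ι → ℝ} {ν : κ → ℝ}

theorem sub_conj (hS : IsEigenbasis S b μ) (hT : IsEigenbasis T c ν) {σ : ι ≃ κ}
    {U : unitary (H →L[ℂ] H)} (hU : ∀ i, (U : H →L[ℂ] H) (c (σ i)) = b i) :
    IsEigenbasis (S - (U : H →L[ℂ] H) * T * star (U : H →L[ℂ] H)) b
      (fun i => μ i - ν (σ i)) := by
  intro i
  have h1 : star (U : H →L[ℂ] H) (b i) = c (σ i) := by
    rw [← hU i, ← mul_apply_eq_comp, Unitary.coe_star_mul_self, one_apply_eq_self]
  rw [sub_apply, mul_apply_eq_comp, mul_apply_eq_comp, h1, hT, map_smul, hU, hS i]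
  push_cast
  rw [sub_smul]

theorem hasSum_one (h : IsEigenbasis T b μ) (hT : IsDensityOperator T) : HasSum μ 1 := by
  simpa using hasSum_of_tsum_ofReal (h.nonneg hT.nonneg) ENNReal.one_ne_top (h.tsum_eq_one hT)

/-- Finitely many eigenvalues of total mass above `1 - ε / 2` are matched exactly; each operator has
less than `ε / 2` of its trace left. -/
theorem exists_unitary_traceNorm_sub_conj_le [TopologicalSpace.SeparableSpace H]
    (hS : IsEigenbasis S b μ) (hSd : IsDensityOperator S) (hT : IsEigenbasis T c ν)
    (hTd : IsDensityOperator T) (e : {i // 0 < μ i} ≃ {j // 0 < ν j})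
    (he : ∀ i, ν (e i) = μ i) {ε : ℝ} (hε : 0 < ε) :
    ∃ U : unitary (H →L[ℂ] H),
      traceNorm (S - (U : H →L[ℂ] H) * T * star (U : H →L[ℂ] H)) ≤ ENNReal.ofReal ε := by
  classical
  have hμ := hS.nonneg hSd.nonneg
  have hν := hT.nonneg hTd.nonneg
  have hμ1 := hS.hasSum_one hSd
  obtain ⟨F, hF⟩ := (hμ1.eventually (lt_mem_nhds (sub_lt_self 1 (half_pos hε)))).exists
  set s : Finset ι := F.filter fun i => 0 < μ i with hs
  have hspos : ∀ i ∈ s, 0 < μ i := fun i hi => (Finset.mem_filter.1 hi).2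
  have hsum : ∑ i ∈ s, μ i = ∑ i ∈ F, μ i :=
    Finset.sum_filter_of_ne fun i _ hi => (hμ i).lt_of_ne' hi
  let f : (s : Set ι) ↪ κ :=
    ⟨fun i => (e ⟨i, hspos i i.2⟩ : κ), fun i j hij => by
      have h1 := e.injective (Subtype.ext hij)
      exact Subtype.ext (congrArg (fun x : {i // 0 < μ i} => (x : ι)) h1)⟩
  obtain ⟨σ, hσ⟩ := exists_equiv_extending (nonempty_equiv_of_hilbertBasis b c) s f
  have hσμ : ∀ i ∈ s, ν (σ i) = μ i := fun i hi => by
    rw [hσ ⟨i, hi⟩]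
    exact he _
  have hν1 : HasSum (fun i => ν (σ i)) 1 := (σ.hasSum_iff (f := ν)).2 (hT.hasSum_one hTd)
  obtain ⟨U, hU⟩ := exists_unitary_apply_eq b c σ
  refine ⟨U, ?_⟩
  have hsa : IsSelfAdjoint (S - (U : H →L[ℂ] H) * T * star (U : H →L[ℂ] H)) :=
    hSd.nonneg.isSelfAdjoint.sub (hTd.nonneg.isSelfAdjoint.conjugate _)
  rw [(hS.sub_conj hT hU).traceNorm_eq hsa]
  -- A summable majorant of `|μ i - ν (σ i)|`: zero on `s`, the sum of the two eigenvalues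
  -- elsewhere.
  set t : ι → ℝ := fun i => μ i + ν (σ i) - 2 * if i ∈ s then μ i else 0 with ht
  have hts : HasSum t (1 + 1 - 2 * ∑ i ∈ s, μ i) := by
    refine (hμ1.add hν1).sub (HasSum.mul_left 2 ?_)
    rw [← Finset.sum_congr rfl fun i (hi : i ∈ s) => if_pos (α := ℝ) (e := 0) hi]
    exact hasSum_sum_of_ne_finset_zero fun i hi => if_neg hi
  have hle : ∀ i, |μ i - ν (σ i)| ≤ t i := by
    intro i
    by_cases hi : i ∈ s
    · simp [ht, hi, hσμ i hi, two_mul]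
    · simp only [ht, hi, if_false, mul_zero, sub_zero]
      rw [abs_le]
      constructor <;> linarith [hμ i, hν (σ i)]
  calc ∑' i, ENNReal.ofReal |μ i - ν (σ i)| ≤ ∑' i, ENNReal.ofReal (t i) :=
        ENNReal.tsum_le_tsum fun i => ENNReal.ofReal_le_ofReal (hle i)
    _ = ENNReal.ofReal (1 + 1 - 2 * ∑ i ∈ s, μ i) := by
        rw [← ENNReal.ofReal_tsum_of_nonneg (fun i => (abs_nonneg _).trans (hle i)) hts.summable,
          hts.tsum_eq]
    _ ≤ ENNReal.ofReal ε := ENNReal.ofReal_le_ofReal (by rw [hsum]; linarith)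

end IsEigenbasis

theorem l1Equivalent_of_eigenvalueSeq_eq [TopologicalSpace.SeparableSpace H] {ρ σ : H →L[ℂ] H}
    (hρ : IsDensityOperator ρ) (hσ : IsDensityOperator σ)
    (h : eigenvalueSeq ρ = eigenvalueSeq σ) : L1Equivalent ρ σ := by
  obtain ⟨ι, b, μ, hb⟩ := hρ.exists_isEigenbasis
  obtain ⟨κ, c, ν, hc⟩ := hσ.exists_isEigenbasis
  have h₁ := hb.exists_equiv_eigenvalueSeq hρ
  rw [h] at h₁
  obtain ⟨e₁, he₁⟩ := h₁
  obtain ⟨e₂, he₂⟩ := hc.exists_equiv_eigenvalueSeq hσ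
  have he : ∀ i, ν ((e₁.trans e₂.symm) i) = μ i := fun i => by
    rw [← he₁, ← he₂, Equiv.trans_apply, Equiv.apply_symm_apply]
  choose U hU using fun n : ℕ => hb.exists_unitary_traceNorm_sub_conj_le hρ hc hσ _ he
    (ε := 1 / ((n : ℝ) + 1)) Nat.one_div_pos_of_nat
  refine ⟨U, tendsto_of_tendsto_of_tendsto_of_le_of_le tendsto_const_nhds ?_
    (fun _ => zero_le) hU⟩
  simpa using ENNReal.tendsto_ofReal (tendsto_one_div_add_atTop_nhds_zero_nat (𝕜 := ℝ))

end QuantumState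

theorem proposition3p1 {H : Type*} [NormedAddCommGroup H] [InnerProductSpace ℂ H]
    [CompleteSpace H] [TopologicalSpace.SeparableSpace H] (ρ₁ ρ₂ : H →L[ℂ] H)
    (hρ₁ : QuantumState.IsDensityOperator ρ₁) (hρ₂ : QuantumState.IsDensityOperator ρ₂)
    (hmaj : QuantumState.MajorizedBy ρ₁ ρ₂)
    (hS : QuantumState.vonNeumannEntropy ρ₁ = QuantumState.vonNeumannEntropy ρ₂)
    (hfin : QuantumState.vonNeumannEntropy ρ₂ < ⊤) :
    QuantumState.L1Equivalent ρ₁ ρ₂ :=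
  QuantumState.l1Equivalent_of_eigenvalueSeq_eq hρ₁ hρ₂
    (QuantumState.eigenvalueSeq_eq_of_majorizedBy hρ₁ hρ₂ hmaj hS hfin.ne)
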